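/- Let $(X,d)$ be a locally compact second-countable metric space with a finite Borel measure $\mu$ that is Ahlfors $\delta$-regular for some $\delta>0$: there is $C_0\ge 1$ with $C_0^{-1}r^{\delta}\le\mu(\overline B(x,r))\le C_0r^{\delta}$ for all $x\in X$ and $0\le r<\operatorname{diam}X$. On the real Hilbert space $L^2(X,\mu)$ consider the Dirichlet form $$\mathcal E(f,g)=\frac12\int_X\int_X\frac{(f(x)-f(y))(g(x)-g(y))}{d(x,y)^{\delta}}\,d\mu(y)\,d\mu(x),\qquad \operatorname{Dom}\mathcal E=\{f\in L^2(X,\mu):\mathcal E(f,f)<\infty\}$$ (integrals over the complement of the diagonal), and let $\Delta$ be the positive self-adjoint operator associated with it (the logarithmic Dirichlet Laplacian): for $w\in L^2(X,\mu)$ let $Rw\in\operatorname{Dom}\mathcal E$ be determined by $\langle Rw,g\rangle_{L^2}+\mathcal E(Rw,g)=\langle w,g\rangle_{L^2}$ for all $g\in\operatorname{Dom}\mathcal E$; then $\operatorname{Dom}\Delta=R\,L^2(X,\mu)$ and $\Delta Rw=w-Rw$. A bounded uniformly continuous function $h:X\to\mathbb R$ is Dini continuous if $\operatorname{Din}(h)=\int_0^1\frac{\omega_h(t)}{t}\,dt<\infty$,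 where $\omega_h(t)=\sup\{|h(x)-h(y)|:d(x,y)\le t\operatorname{diam}X\}$; put $\|h\|_{\operatorname{Din}}=\|h\|_\infty+\operatorname{Din}(h)$. Let $\mathrm m_h$ denote multiplication by $h$ on $L^2(X,\mu)$. Then there is a constant $C>0$, depending only on $(X,d,\mu)$ and $\delta$, such that for every Dini continuous $h$: (a) the formula $$\mathrm K_hf(x)=\int_X\frac{h(x)-h(y)}{d(x,y)^{\delta}}f(y)\,d\mu(y)$$ (the integral being absolutely convergent for $\mu$-almost every $x$, for each $f\in L^2(X,\mu)$) defines a bounded operator $\mathrm K_h$ on $L^2(X,\mu)$ with $\|\mathrm K_h\|\le C\|h\|_{\operatorname{Din}}$; (b) $\mathrm m_h$ maps $\operatorname{Dom}\Delta$ into $\operatorname{Dom}\Delta$; (c) the commutator $[\Delta,\mathrm m_h]:\operatorname{Dom}\Delta\to L^2(X,\mu)$ extends to $\mathrm K_h$, that is, $\Delta(hf)-h\,\Delta f=\mathrm K_hf$ for all $f\in\operatorname{Dom}\Delta$. -/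

import Mathlib

open MeasureTheory
open scoped ENNReal

noncomputable section

namespace LogLaplacian

/-! ### Ahlfors regular metric-measure spaces -/

/-- Ahlfors `δ`-regularity: `C⁻¹ r^δ ≤ μ (closedBall x r) ≤ C r^δ` for all `x` and all
`0 ≤ r < diam X`. The diameter is taken in `[0, ∞]`, so unbounded spaces are treated correctly. -/
def IsAhlforsRegular {X : Type*} [MetricSpace X] [MeasurableSpace X]
    (δ : ℝ) (μ : Measure X) : Prop :=
  ∃ C : ℝ, 1 ≤ C ∧ ∀ (x : X) (r : ℝ), 0 ≤ r →
    ENNReal.ofReal r < Metric.ediam (Set.univ : Set X) →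
      ENNReal.ofReal (C⁻¹ * r ^ δ) ≤ μ (Metric.closedBall x r) ∧
      μ (Metric.closedBall x r) ≤ ENNReal.ofReal (C * r ^ δ)

/-! ### The operator associated with a bilinear form -/

section Form

variable {H : Type*} [NormedAddCommGroup H] [InnerProductSpace ℝ H]

/-- `IsResolvent Q w f` says that `f = R_Q w`, that is, `f ∈ Dom Q` and
`⟨f, g⟩ + Q (f, g) = ⟨w, g⟩` for every `g ∈ Dom Q`. Here `Dom Q` is the submodule `D`. -/
def IsResolvent {D : Submodule ℝ H} (Q : LinearMap.BilinForm ℝ D) (w : H) (f : D) : Prop :=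
  ∀ g : D, inner ℝ (f : H) (g : H) + Q f g = inner ℝ w (g : H)

/-- The graph `{(R_Q w, w - R_Q w) : w ∈ H}` of the operator associated with the form `Q`. -/
def formOperatorGraph {D : Submodule ℝ H} (Q : LinearMap.BilinForm ℝ D) :
    Submodule ℝ (H × H) where
  carrier := {p | ∃ (w : H) (f : D), IsResolvent Q w f ∧ p = ((f : H), w - (f : H))}
  zero_mem' := ⟨0, 0, fun g => by simp, by ext <;> simp⟩
  add_mem' := by
    rintro _ _ ⟨w, f, hf, rfl⟩ ⟨w', f', hf', rfl⟩
    refine ⟨w + w', f + f', fun g => ?_, ?_⟩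
    · rw [inner_add_left, ← hf g, ← hf' g]
      simp only [Submodule.coe_add, inner_add_left, map_add, LinearMap.add_apply]
      ring
    · ext
      · simp
      · simp only [Prod.mk_add_mk, Submodule.coe_add]
        abel
  smul_mem' := by
    rintro c _ ⟨w, f, hf, rfl⟩
    refine ⟨c • w, c • f, fun g => ?_, ?_⟩
    · rw [real_inner_smul_left, ← hf g]
      simp only [Submodule.coe_smul, real_inner_smul_left, map_smul, LinearMap.smul_apply,
        smul_eq_mul]
      ring
    · ext <;> simp [smul_sub]

/-- The operator `A_Q` associated with `Q`: its domain is `R_Q H` and `A_Q (R_Q w) = w - R_Q w`. -/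
def formOperator {D : Submodule ℝ H} (Q : LinearMap.BilinForm ℝ D) : H →ₗ.[ℝ] H :=
  (formOperatorGraph Q).toLinearPMap

/-- For a densely defined form the graph above is single-valued, hence it is the graph of `A_Q`. -/
theorem formOperator_graph {D : Submodule ℝ H} (hD : Dense (D : Set H))
    (Q : LinearMap.BilinForm ℝ D) : (formOperator Q).graph = formOperatorGraph Q := by
  refine Submodule.toLinearPMap_graph_eq _ ?_
  rintro _ ⟨w, f, hf, rfl⟩ h0
  have hf0 : f = 0 := Subtype.ext h0
  subst hf0
  have hw : w = 0 := by
    refine hD.eq_zero_of_inner_left ℝ fun g hg => ?_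
    simpa using (hf ⟨g, hg⟩).symm
  simp [hw]

end Form

/-! ### The Dirichlet form and the logarithmic Dirichlet Laplacian -/

section Energy

variable {X : Type*} [MetricSpace X]

/-- The integrand `(f(x) - f(y)) (g(x) - g(y)) / d(x,y)^δ`; it vanishes on the diagonal, so that
integrals of it over `X × X` are integrals over the complement of the diagonal. -/
def energyDensity (δ : ℝ) (f g : X → ℝ) (p : X × X) : ℝ :=
  (f p.1 - f p.2) * (g p.1 - g p.2) / dist p.1 p.2 ^ δ

theorem energyDensity_self_nonneg (δ : ℝ) (f : X → ℝ) (p : X × X) :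
    0 ≤ energyDensity δ f f p :=
  div_nonneg (mul_self_nonneg _) (Real.rpow_nonneg dist_nonneg _)

theorem abs_energyDensity_le (δ : ℝ) (f g : X → ℝ) (p : X × X) :
    |energyDensity δ f g p| ≤ energyDensity δ f f p + energyDensity δ g g p := by
  have hd : (0 : ℝ) ≤ dist p.1 p.2 ^ δ := Real.rpow_nonneg dist_nonneg _
  unfold energyDensity
  rw [← add_div, abs_div, abs_of_nonneg hd]
  refine div_le_div_of_nonneg_right ?_ hd
  rw [abs_le]
  constructor <;>
    nlinarith [sq_nonneg ((f p.1 - f p.2) + (g p.1 - g p.2)),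
      sq_nonneg ((f p.1 - f p.2) - (g p.1 - g p.2)),
      sq_nonneg (f p.1 - f p.2), sq_nonneg (g p.1 - g p.2)]

theorem energyDensity_add_self_le (δ : ℝ) (f g : X → ℝ) (p : X × X) :
    energyDensity δ (f + g) (f + g) p ≤
      2 * energyDensity δ f f p + 2 * energyDensity δ g g p := by
  have hd : (0 : ℝ) ≤ dist p.1 p.2 ^ δ := Real.rpow_nonneg dist_nonneg _
  unfold energyDensity
  rw [← mul_div_assoc, ← mul_div_assoc, ← add_div]
  refine div_le_div_of_nonneg_right ?_ hd
  simp only [Pi.add_apply]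
  nlinarith [sq_nonneg ((f p.1 - f p.2) - (g p.1 - g p.2))]

variable [SecondCountableTopology X] [MeasurableSpace X] [BorelSpace X]

theorem measurable_energyDensity (δ : ℝ) {f g : X → ℝ} (hf : Measurable f) (hg : Measurable g) :
    Measurable (energyDensity δ f g) := by
  unfold energyDensity
  exact (((hf.comp measurable_fst).sub (hf.comp measurable_snd)).mul
    ((hg.comp measurable_fst).sub (hg.comp measurable_snd))).div
      ((measurable_fst.dist measurable_snd).pow_const δ)

variable (δ : ℝ) (μ : Measure X) [IsFiniteMeasure μ]

theorem energyDensity_congr {f f' g g' : X → ℝ} (hf : f =ᵐ[μ] f') (hg : g =ᵐ[μ] g') :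
    energyDensity δ f g =ᵐ[μ.prod μ] energyDensity δ f' g' := by
  filter_upwards [Measure.quasiMeasurePreserving_fst.ae_eq_comp hf,
    Measure.quasiMeasurePreserving_snd.ae_eq_comp hf,
    Measure.quasiMeasurePreserving_fst.ae_eq_comp hg,
    Measure.quasiMeasurePreserving_snd.ae_eq_comp hg] with p h1 h2 h3 h4
  simp only [Function.comp_apply] at h1 h2 h3 h4
  simp only [energyDensity, h1, h2, h3, h4]

/-- `Dom E`: those `f ∈ L²(X, μ)` for which `|f(x) - f(y)|² / d(x,y)^δ` has finite integral. -/
def formDomain : Submodule ℝ (Lp ℝ 2 μ) where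
  carrier := {f | Integrable (energyDensity δ (f : X → ℝ) f) (μ.prod μ)}
  zero_mem' := by
    have h := energyDensity_congr δ μ (Lp.coeFn_zero ℝ 2 μ) (Lp.coeFn_zero ℝ 2 μ)
    refine (integrable_congr h).2 ?_
    have h0 : energyDensity δ (0 : X → ℝ) 0 = 0 := by
      funext p
      simp [energyDensity]
    rw [h0]
    exact integrable_zero _ _ _
  add_mem' := by
    intro f g hf hg
    have h := energyDensity_congr δ μ (Lp.coeFn_add f g) (Lp.coeFn_add f g)
    refine (integrable_congr h).2 ?_
    have hm : Measurable ((f : X → ℝ) + (g : X → ℝ)) :=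
      (Lp.stronglyMeasurable f).measurable.add (Lp.stronglyMeasurable g).measurable
    refine Integrable.mono' ((hf.const_mul 2).add (hg.const_mul 2))
      (measurable_energyDensity δ hm hm).aestronglyMeasurable (Filter.Eventually.of_forall ?_)
    intro p
    rw [Real.norm_eq_abs, abs_of_nonneg (energyDensity_self_nonneg δ _ p)]
    exact energyDensity_add_self_le δ _ _ p
  smul_mem' := by
    intro c f hf
    have h := energyDensity_congr δ μ (Lp.coeFn_smul c f) (Lp.coeFn_smul c f)
    refine (integrable_congr h).2 ((hf.const_mul (c * c)).congr (Filter.Eventually.of_forall ?_))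
    intro p
    simp only [energyDensity, Pi.smul_apply, smul_eq_mul]
    ring

variable {δ μ} in
theorem integrable_energyDensity (f g : formDomain δ μ) :
    Integrable (energyDensity δ ((f : Lp ℝ 2 μ) : X → ℝ) (g : Lp ℝ 2 μ)) (μ.prod μ) := by
  have hf : Integrable (energyDensity δ ((f : Lp ℝ 2 μ) : X → ℝ) (f : Lp ℝ 2 μ)) (μ.prod μ) := f.2
  have hg : Integrable (energyDensity δ ((g : Lp ℝ 2 μ) : X → ℝ) (g : Lp ℝ 2 μ)) (μ.prod μ) := g.2
  refine Integrable.mono' (hf.add hg)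
    (measurable_energyDensity δ (Lp.stronglyMeasurable _).measurable
      (Lp.stronglyMeasurable _).measurable).aestronglyMeasurable
    (Filter.Eventually.of_forall fun p => ?_)
  rw [Real.norm_eq_abs]
  exact abs_energyDensity_le δ _ _ p

/-- The Dirichlet form
`E(f, g) = 1/2 ∫∫ (f(x) - f(y)) (g(x) - g(y)) / d(x,y)^δ dμ(y) dμ(x)` on `Dom E`. -/
def dirichletForm : LinearMap.BilinForm ℝ (formDomain δ μ) :=
  LinearMap.mk₂ ℝ
    (fun f g => (1 / 2 : ℝ) *
      ∫ p, energyDensity δ ((f : Lp ℝ 2 μ) : X → ℝ) (g : Lp ℝ 2 μ) p ∂(μ.prod μ))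
    (by
      intro f f' g
      rw [← mul_add, ← integral_add (integrable_energyDensity f g) (integrable_energyDensity f' g)]
      congr 1
      refine integral_congr_ae ((energyDensity_congr δ μ
        (Lp.coeFn_add (f : Lp ℝ 2 μ) (f' : Lp ℝ 2 μ)) (ae_eq_refl _)).trans
          (Filter.Eventually.of_forall fun p => ?_))
      simp only [energyDensity, Pi.add_apply]
      ring)
    (by
      intro c f g
      rw [smul_eq_mul, mul_left_comm, ← integral_const_mul c]
      congr 1
      refine integral_congr_ae ((energyDensity_congr δ μ
        (Lp.coeFn_smul c (f : Lp ℝ 2 μ)) (ae_eq_refl _)).trans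
          (Filter.Eventually.of_forall fun p => ?_))
      simp only [energyDensity, Pi.smul_apply, smul_eq_mul]
      ring)
    (by
      intro f g g'
      rw [← mul_add, ← integral_add (integrable_energyDensity f g) (integrable_energyDensity f g')]
      congr 1
      refine integral_congr_ae ((energyDensity_congr δ μ (ae_eq_refl _)
        (Lp.coeFn_add (g : Lp ℝ 2 μ) (g' : Lp ℝ 2 μ))).trans
          (Filter.Eventually.of_forall fun p => ?_))
      simp only [energyDensity, Pi.add_apply]
      ring)
    (by
      intro c f g
      rw [smul_eq_mul, mul_left_comm, ← integral_const_mul c]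
      congr 1
      refine integral_congr_ae ((energyDensity_congr δ μ (ae_eq_refl _)
        (Lp.coeFn_smul c (g : Lp ℝ 2 μ))).trans
          (Filter.Eventually.of_forall fun p => ?_))
      simp only [energyDensity, Pi.smul_apply, smul_eq_mul]
      ring)

/-- The logarithmic Dirichlet Laplacian `Δ`, an unbounded operator on `L²(X, μ)`. -/
def logLaplacian : Lp ℝ 2 μ →ₗ.[ℝ] Lp ℝ 2 μ :=
  formOperator (dirichletForm δ μ)

end Energy

/-! ### Dini continuous functions -/

section Dini

variable {X : Type*} [MetricSpace X]

/-- The modulus of continuity `ω_h(t) = sup {|h(x) - h(y)| : d(x,y) ≤ t diam X}`, in `[0, ∞]`. -/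
def modulus (h : X → ℝ) (t : ℝ) : ℝ≥0∞ :=
  ⨆ (x : X) (y : X) (_ : edist x y ≤ ENNReal.ofReal t * Metric.ediam (Set.univ : Set X)),
    ENNReal.ofReal |h x - h y|

/-- The Dini constant `Din(h) = ∫₀¹ ω_h(t) / t dt`, in `[0, ∞]`. -/
def diniConst (h : X → ℝ) : ℝ≥0∞ :=
  ∫⁻ t in Set.Ioc (0 : ℝ) 1, modulus h t / ENNReal.ofReal t

/-- Dini continuity: `h` is bounded and uniformly continuous, and `Din(h) < ∞`. -/
structure IsDini (h : X → ℝ) : Prop where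
  uniformContinuous : UniformContinuous h
  bounded : ∃ M : ℝ, ∀ x, |h x| ≤ M
  diniConst_lt_top : diniConst h < ∞

/-- The Dini norm `‖h‖_Din = ‖h‖_∞ + Din(h)`; for Dini continuous `h` both terms are finite. -/
def diniNorm (h : X → ℝ) : ℝ :=
  ((⨆ x : X, ENNReal.ofReal |h x|) + diniConst h).toReal

variable [SecondCountableTopology X] [MeasurableSpace X] [BorelSpace X]

theorem IsDini.memLp_top {h : X → ℝ} (hh : IsDini h) (μ : Measure X) : MemLp h ∞ μ := by
  obtain ⟨M, hM⟩ := hh.bounded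
  exact memLp_top_of_bound hh.uniformContinuous.continuous.aestronglyMeasurable M
    (Filter.Eventually.of_forall fun x => by simpa [Real.norm_eq_abs] using hM x)

end Dini

/-! ### Multiplication operators and integral kernels -/

section Operators

variable {X : Type*} [MeasurableSpace X] {μ : Measure X}

/-- The multiplication operator `m_h` on `L²(X, μ)` of a function `h ∈ L^∞(X, μ)`. -/
def mulOp (h : X → ℝ) (hh : MemLp h ∞ μ) : Lp ℝ 2 μ →L[ℝ] Lp ℝ 2 μ :=
  (ContinuousLinearMap.mul ℝ ℝ).holderL μ ∞ 2 2 (hh.toLp h)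

theorem coeFn_mulOp (h : X → ℝ) (hh : MemLp h ∞ μ) (f : Lp ℝ 2 μ) :
    mulOp h hh f =ᵐ[μ] fun x => h x * f x := by
  have h1 := (ContinuousLinearMap.mul ℝ ℝ).coeFn_holder (r := 2) (hh.toLp h) f
  filter_upwards [h1, hh.coeFn_toLp] with x hx hx'
  rw [← hx']
  exact hx

/-- The bounded operator `K` on `L²(X, μ)` is the integral operator with kernel `k`: for every
`f ∈ L²(X, μ)` and almost every `x`, the integral `∫ k(x,y) f(y) dμ(y)` converges absolutely and
equals `(K f)(x)`. -/
def IsIntegralOperator (k : X → X → ℝ) (K : Lp ℝ 2 μ →L[ℝ] Lp ℝ 2 μ) : Prop :=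
  ∀ f : Lp ℝ 2 μ, ∀ᵐ x ∂μ,
    Integrable (fun y => k x y * f y) μ ∧ K f x = ∫ y, k x y * f y ∂μ

/-- The kernel `(h(x) - h(y)) / d(x,y)^δ`, with value `0` on the diagonal. -/
def commutatorKernel {X : Type*} [MetricSpace X] (δ : ℝ) (h : X → ℝ) (x y : X) : ℝ :=
  (h x - h y) / dist x y ^ δ

end Operators

end LogLaplacian

end

/-! Write `k(x,y) = (h(x) - h(y)) / d(x,y)^δ`. Expanding products shows that the energy densities of
`(hf, g)` and `(f, hg)` differ by `k(x,y) f(y) g(x) + k(y,x) f(x) g(y)`. The two terms have equal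
integrals, so the factor `1/2` gives `E(hf, g) = E(f, hg) + ⟨K_h f, g⟩` (`dirichletForm_mulOp`). If
`f = R w`, testing the resolvent equation against `hg` then yields `hf = R (hw + K_h f)`. Hence `hf
∈ Dom Δ` and `Δ(hf) = h Δf + K_h f` (`mulOp_mem_formOperatorGraph`).

The analytic input is the bound `∫ |k(x,y)| dμ(y) ≤ C ‖h‖_Din`
(`exists_lintegral_commutatorKernel_le`). The far part of the kernel is bounded through `‖h‖_∞`. The
near part is averaged over dyadic scales, where the growth of balls cancels the singularity and
`Din(h)` remains. Since `|k|` is symmetric, the Schur test (`exists_isIntegralOperator`) bounds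
`K_h`. The same estimate makes `Dom E` stable under multiplication by `h`.

Finally, the resolvent graph defines an operator only if it is single-valued, which follows from
density of `Dom E` (`dense_formDomain`). -/

namespace LogLaplacian

/-! ### The Schur test -/

section Schur

variable {X : Type*} [MeasurableSpace X] {μ : Measure X}

/-- Weighted Cauchy–Schwarz inequality. -/
theorem lintegral_mul_sq_le {k g : X → ℝ≥0∞} (hk : Measurable k) (hg : Measurable g) :
    (∫⁻ y, k y * g y ∂μ) ^ (2 : ℝ) ≤ (∫⁻ y, k y ∂μ) * ∫⁻ y, k y * g y ^ (2 : ℝ) ∂μ := by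
  -- This is Cauchy–Schwarz for the functions `1` and `g` with respect to the measure `k dμ`.
  have h := ENNReal.lintegral_mul_le_Lp_mul_Lq (μ.withDensity k) Real.HolderConjugate.two_two
    (f := fun _ => 1) (g := g) aemeasurable_const hg.aemeasurable
  rw [lintegral_withDensity_eq_lintegral_mul μ hk
      (g := ((fun _ => 1) * g : X → ℝ≥0∞)) (measurable_const.mul hg),
    lintegral_withDensity_eq_lintegral_mul μ hk (measurable_const.pow_const _),
    lintegral_withDensity_eq_lintegral_mul μ hk (hg.pow_const _)] at h
  simp only [Pi.mul_apply, one_mul, ENNReal.one_rpow, mul_one] at h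
  refine (ENNReal.rpow_le_rpow h (by norm_num : (0 : ℝ) ≤ 2)).trans ?_
  rw [ENNReal.mul_rpow_of_nonneg _ _ (by norm_num), ← ENNReal.rpow_mul, ← ENNReal.rpow_mul]
  norm_num

theorem lintegral_enorm_sq_lt_top (f : Lp ℝ 2 μ) : ∫⁻ y, ‖f y‖ₑ ^ (2 : ℝ) ∂μ < ∞ := by
  simpa using lintegral_rpow_enorm_lt_top_of_eLpNorm_lt_top (p := 2) (by norm_num) (by norm_num)
    (Lp.memLp f).2

theorem measurable_coe_Lp (f : Lp ℝ 2 μ) : Measurable (f : X → ℝ) :=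
  (Lp.stronglyMeasurable f).measurable

variable [SFinite μ] {k : X → X → ℝ} {A : NNReal}

theorem lintegral_lintegral_kernel_le (hk : Measurable (Function.uncurry k))
    (hc : ∀ y, ∫⁻ x, ‖k x y‖ₑ ∂μ ≤ A) {g : X → ℝ≥0∞} (hg : Measurable g) :
    ∫⁻ x, ∫⁻ y, ‖k x y‖ₑ * g y ∂μ ∂μ ≤ A * ∫⁻ y, g y ∂μ := by
  rw [lintegral_lintegral_swap (hk.enorm.mul (hg.comp measurable_snd)).aemeasurable,
    ← lintegral_const_mul _ hg]
  refine lintegral_mono fun y => ?_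
  have hky : Measurable fun x => k x y := hk.comp (measurable_id.prodMk measurable_const)
  rw [lintegral_mul_const _ hky.enorm]
  gcongr
  exact hc y

/-- Splitting `|k| g` as `|k|^(1/2) · |k|^(1/2) g` costs one factor `A` from the rows. After
exchanging the integrals, the columns give the second one. -/
theorem lintegral_sq_kernel_le (hk : Measurable (Function.uncurry k))
    (hr : ∀ x, ∫⁻ y, ‖k x y‖ₑ ∂μ ≤ A) (hc : ∀ y, ∫⁻ x, ‖k x y‖ₑ ∂μ ≤ A)
    {g : X → ℝ≥0∞} (hg : Measurable g) :
    ∫⁻ x, (∫⁻ y, ‖k x y‖ₑ * g y ∂μ) ^ (2 : ℝ) ∂μ ≤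
      (A : ℝ≥0∞) ^ (2 : ℝ) * ∫⁻ y, g y ^ (2 : ℝ) ∂μ := by
  calc ∫⁻ x, (∫⁻ y, ‖k x y‖ₑ * g y ∂μ) ^ (2 : ℝ) ∂μ
      ≤ ∫⁻ x, A * ∫⁻ y, ‖k x y‖ₑ * g y ^ (2 : ℝ) ∂μ ∂μ := by
        refine lintegral_mono fun x => ?_
        have hkx : Measurable (k x) := hk.comp (measurable_const.prodMk measurable_id)
        refine (lintegral_mul_sq_le hkx.enorm hg).trans ?_
        gcongr
        exact hr x
    _ = A * ∫⁻ x, ∫⁻ y, ‖k x y‖ₑ * g y ^ (2 : ℝ) ∂μ ∂μ :=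
        lintegral_const_mul' _ _ ENNReal.coe_ne_top
    _ ≤ A * (A * ∫⁻ y, g y ^ (2 : ℝ) ∂μ) := by
        gcongr
        exact lintegral_lintegral_kernel_le hk hc (hg.pow_const _)
    _ = _ := by rw [← mul_assoc, ENNReal.rpow_two, sq]

theorem ae_integrable_kernel_mul (hk : Measurable (Function.uncurry k))
    (hr : ∀ x, ∫⁻ y, ‖k x y‖ₑ ∂μ ≤ A) (hc : ∀ y, ∫⁻ x, ‖k x y‖ₑ ∂μ ≤ A) (f : Lp ℝ 2 μ) :
    ∀ᵐ x ∂μ, Integrable (fun y => k x y * f y) μ := by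
  have hf := measurable_coe_Lp f
  have hm : Measurable fun p : X × X => ‖k p.1 p.2‖ₑ * ‖f p.2‖ₑ :=
    hk.enorm.mul (hf.comp measurable_snd).enorm
  have hfin := (lintegral_sq_kernel_le hk hr hc hf.enorm).trans_lt
    (ENNReal.mul_lt_top (ENNReal.rpow_lt_top_of_nonneg (by norm_num) ENNReal.coe_ne_top)
      (lintegral_enorm_sq_lt_top f))
  filter_upwards [ae_lt_top (hm.lintegral_prod_right'.pow_const (2 : ℝ)) hfin.ne] with x hx
  refine ⟨((hk.comp (measurable_const.prodMk measurable_id)).mul hf).aestronglyMeasurable, ?_⟩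
  rw [HasFiniteIntegral]
  simp only [enorm_mul]
  exact (ENNReal.rpow_lt_top_iff_of_pos (by norm_num)).1 hx

theorem eLpNorm_integral_kernel_le (hk : Measurable (Function.uncurry k))
    (hr : ∀ x, ∫⁻ y, ‖k x y‖ₑ ∂μ ≤ A) (hc : ∀ y, ∫⁻ x, ‖k x y‖ₑ ∂μ ≤ A) (f : Lp ℝ 2 μ) :
    eLpNorm (fun x => ∫ y, k x y * f y ∂μ) 2 μ ≤ A * eLpNorm f 2 μ := by
  rw [eLpNorm_eq_lintegral_rpow_enorm_toReal (by norm_num) (by norm_num),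
    eLpNorm_eq_lintegral_rpow_enorm_toReal (by norm_num) (by norm_num)]
  simp only [ENNReal.toReal_ofNat]
  have h : ∫⁻ x, ‖∫ y, k x y * f y ∂μ‖ₑ ^ (2 : ℝ) ∂μ ≤
      (A : ℝ≥0∞) ^ (2 : ℝ) * ∫⁻ y, ‖f y‖ₑ ^ (2 : ℝ) ∂μ := by
    refine le_trans (lintegral_mono fun x => ?_)
      (lintegral_sq_kernel_le hk hr hc (measurable_coe_Lp f).enorm)
    gcongr
    refine (enorm_integral_le_lintegral_enorm _).trans_eq ?_
    simp only [enorm_mul]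
  refine (ENNReal.rpow_le_rpow h (by norm_num : (0 : ℝ) ≤ 1 / 2)).trans ?_
  rw [ENNReal.mul_rpow_of_nonneg _ _ (by norm_num), ← ENNReal.rpow_mul]
  norm_num

theorem memLp_integral_kernel (hk : Measurable (Function.uncurry k))
    (hr : ∀ x, ∫⁻ y, ‖k x y‖ₑ ∂μ ≤ A) (hc : ∀ y, ∫⁻ x, ‖k x y‖ₑ ∂μ ≤ A) (f : Lp ℝ 2 μ) :
    MemLp (fun x => ∫ y, k x y * f y ∂μ) 2 μ := by
  refine ⟨?_, (eLpNorm_integral_kernel_le hk hr hc f).trans_lt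
    (ENNReal.mul_lt_top ENNReal.coe_lt_top (Lp.memLp f).2)⟩
  exact (StronglyMeasurable.integral_prod_right' (f := fun p : X × X => k p.1 p.2 * f p.2)
    (hk.mul ((measurable_coe_Lp f).comp measurable_snd)).stronglyMeasurable).aestronglyMeasurable

/-- **Schur test**. -/
theorem exists_isIntegralOperator (hk : Measurable (Function.uncurry k))
    (hr : ∀ x, ∫⁻ y, ‖k x y‖ₑ ∂μ ≤ A) (hc : ∀ y, ∫⁻ x, ‖k x y‖ₑ ∂μ ≤ A) :
    ∃ K : Lp ℝ 2 μ →L[ℝ] Lp ℝ 2 μ, IsIntegralOperator k K ∧ ‖K‖ ≤ A := by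
  let T : Lp ℝ 2 μ →ₗ[ℝ] Lp ℝ 2 μ :=
    { toFun := fun f => (memLp_integral_kernel hk hr hc f).toLp _
      map_add' := fun f g => by
        rw [← MemLp.toLp_add]
        refine MemLp.toLp_congr _ _ ?_
        filter_upwards [ae_integrable_kernel_mul hk hr hc f,
          ae_integrable_kernel_mul hk hr hc g] with x hf hg
        rw [Pi.add_apply, ← integral_add hf hg]
        refine integral_congr_ae ?_
        filter_upwards [Lp.coeFn_add f g] with y hy
        rw [hy, Pi.add_apply, mul_add]
      map_smul' := fun c f => by
        rw [RingHom.id_apply, ← MemLp.toLp_const_smul]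
        refine MemLp.toLp_congr _ _ (Filter.Eventually.of_forall fun x => ?_)
        rw [Pi.smul_apply, ← integral_smul]
        refine integral_congr_ae ?_
        filter_upwards [Lp.coeFn_smul c f] with y hy
        rw [hy, Pi.smul_apply, smul_eq_mul, smul_eq_mul, mul_left_comm] }
  refine ⟨T.mkContinuous A fun f => ?_, fun f => ?_, T.mkContinuous_norm_le A.2 _⟩
  · change ‖(memLp_integral_kernel hk hr hc f).toLp _‖ ≤ _
    rw [Lp.norm_toLp, Lp.norm_def, ← ENNReal.coe_toReal A, ← ENNReal.toReal_mul]
    exact ENNReal.toReal_mono (ENNReal.mul_lt_top ENNReal.coe_lt_top (Lp.memLp f).2).ne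
      (eLpNorm_integral_kernel_le hk hr hc f)
  · filter_upwards [ae_integrable_kernel_mul hk hr hc f,
      (memLp_integral_kernel hk hr hc f).coeFn_toLp] with x h1 h2
    exact ⟨h1, h2⟩

theorem integrable_kernel_mul_sq (hk : Measurable (Function.uncurry k))
    (hc : ∀ y, ∫⁻ x, ‖k x y‖ₑ ∂μ ≤ A) (f : Lp ℝ 2 μ) :
    Integrable (fun p : X × X => k p.1 p.2 * f p.2 ^ 2) (μ.prod μ) := by
  have hf := measurable_coe_Lp f
  have hm : Measurable fun p : X × X => k p.1 p.2 * f p.2 ^ 2 :=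
    hk.mul ((hf.comp measurable_snd).pow_const 2)
  refine ⟨hm.aestronglyMeasurable, ?_⟩
  rw [HasFiniteIntegral, lintegral_prod _ hm.enorm.aemeasurable]
  refine lt_of_le_of_lt (le_of_eq ?_)
    ((lintegral_lintegral_kernel_le hk hc (hf.enorm.pow_const (2 : ℝ))).trans_lt
      (ENNReal.mul_lt_top ENNReal.coe_lt_top (lintegral_enorm_sq_lt_top f)))
  simp only [enorm_mul, enorm_pow, ENNReal.rpow_two]

/-- By the arithmetic-geometric mean inequality `|k f(y) g(x)|` is at most `|k| (f(y)² + g(x)²)`.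
The column bound controls the first term, the row bound the second. This licenses Fubini in the
pairing `⟨K f, g⟩`. -/
theorem integrable_kernel_mul_mul (hk : Measurable (Function.uncurry k))
    (hr : ∀ x, ∫⁻ y, ‖k x y‖ₑ ∂μ ≤ A) (hc : ∀ y, ∫⁻ x, ‖k x y‖ₑ ∂μ ≤ A) (f g : Lp ℝ 2 μ) :
    Integrable (fun p : X × X => k p.1 p.2 * f p.2 * g p.1) (μ.prod μ) := by
  have h1 := integrable_kernel_mul_sq hk hc f
  have h2 := (integrable_kernel_mul_sq (k := fun x y => k y x) (hk.comp measurable_swap) hr g).swap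
  refine Integrable.mono' (h1.norm.add h2.norm)
    ((hk.mul ((measurable_coe_Lp f).comp measurable_snd)).mul
      ((measurable_coe_Lp g).comp measurable_fst)).aestronglyMeasurable
    (Filter.Eventually.of_forall fun p => ?_)
  simp only [Pi.add_apply, Function.comp_apply, Prod.fst_swap, Prod.snd_swap, norm_mul, norm_pow,
    Real.norm_eq_abs]
  nlinarith [mul_nonneg (abs_nonneg (k p.1 p.2)) (sq_nonneg (|f p.2| - |g p.1|)),
    mul_nonneg (abs_nonneg (k p.1 p.2)) (add_nonneg (sq_nonneg |f p.2|) (sq_nonneg |g p.1|))]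

theorem IsIntegralOperator.inner_eq {K : Lp ℝ 2 μ →L[ℝ] Lp ℝ 2 μ} (hK : IsIntegralOperator k K)
    {f g : Lp ℝ 2 μ}
    (hi : Integrable (fun p : X × X => k p.1 p.2 * f p.2 * g p.1) (μ.prod μ)) :
    inner ℝ (K f) g = ∫ p, k p.1 p.2 * f p.2 * g p.1 ∂(μ.prod μ) := by
  rw [L2.inner_def, integral_prod _ hi]
  refine integral_congr_ae ?_
  filter_upwards [hK f] with x hx
  rw [integral_mul_const, ← hx.2]
  exact mul_comm _ _

end Schur

/-! ### Integrability of the commutator kernel -/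

section Kernel

variable {X : Type*} [MetricSpace X]

/-- In an unbounded space the lower volume bound would hold at every radius and exceed the finite
total mass. -/
theorem ediam_ne_top [MeasurableSpace X] {μ : Measure X} [IsFiniteMeasure μ] {δ : ℝ} (hδ : 0 < δ)
    (hμ : IsAhlforsRegular δ μ) : Metric.ediam (Set.univ : Set X) ≠ ∞ := by
  intro htop
  obtain ⟨C, hC, H⟩ := hμ
  have hC0 : 0 < C := by linarith
  have hne : Nonempty X := by
    by_contra hX
    rw [not_nonempty_iff] at hX
    simp [Set.univ_eq_empty_iff.2 hX] at htop
  obtain ⟨x⟩ := hne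
  set M := (μ Set.univ).toReal
  -- The radius is chosen so that the lower bound `C⁻¹ r^δ` equals `M + 1`, one more than the total
  -- mass.
  set r : ℝ := (C * (M + 1)) ^ δ⁻¹
  have hM : 0 ≤ M := ENNReal.toReal_nonneg
  have hr : r ^ δ = C * (M + 1) := by
    rw [← Real.rpow_mul (by positivity), inv_mul_cancel₀ hδ.ne', Real.rpow_one]
  have h := (H x r (by positivity) (by rw [htop]; exact ENNReal.ofReal_lt_top)).1.trans
    (measure_mono (Set.subset_univ _))
  rw [hr, inv_mul_cancel_left₀ hC0.ne', ENNReal.ofReal_le_iff_le_toReal (measure_ne_top _ _)] at h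
  change M + 1 ≤ M at h
  linarith

theorem monotone_modulus (h : X → ℝ) : Monotone (modulus h) := by
  intro s t hst
  refine iSup_mono fun x => iSup_mono fun y => iSup_mono' fun hxy => ⟨hxy.trans ?_, le_rfl⟩
  gcongr

theorem le_modulus (h : X → ℝ) {x y : X} {t : ℝ}
    (hxy : edist x y ≤ ENNReal.ofReal t * Metric.ediam (Set.univ : Set X)) :
    ENNReal.ofReal |h x - h y| ≤ modulus h t :=
  le_iSup_of_le x (le_iSup_of_le y (le_iSup_of_le hxy le_rfl))

theorem ofReal_abs_sub_le {X : Type*} (h : X → ℝ) (x y : X) :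
    ENNReal.ofReal |h x - h y| ≤ 2 * ⨆ x, ENNReal.ofReal |h x| := by
  rw [two_mul]
  refine (ENNReal.ofReal_le_ofReal (abs_sub (h x) (h y))).trans ?_
  rw [ENNReal.ofReal_add (abs_nonneg _) (abs_nonneg _)]
  exact add_le_add (le_iSup (fun x => ENNReal.ofReal |h x|) x)
    (le_iSup (fun x => ENNReal.ofReal |h x|) y)

theorem IsDini.ofReal_diniNorm {h : X → ℝ} (hh : IsDini h) :
    ENNReal.ofReal (diniNorm h) = (⨆ x : X, ENNReal.ofReal |h x|) + diniConst h := by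
  refine ENNReal.ofReal_toReal (ENNReal.add_lt_top.2 ⟨?_, hh.diniConst_lt_top⟩).ne
  obtain ⟨M, hM⟩ := hh.bounded
  exact (iSup_le fun x => ENNReal.ofReal_le_ofReal (hM x)).trans_lt ENNReal.ofReal_lt_top

theorem enorm_commutatorKernel (δ : ℝ) (h : X → ℝ) (x y : X) :
    ‖commutatorKernel δ h x y‖ₑ = ENNReal.ofReal (|h x - h y| * dist x y ^ (-δ)) := by
  rw [commutatorKernel, Real.enorm_eq_ofReal_abs, abs_div, Real.rpow_neg dist_nonneg,
    abs_of_nonneg (Real.rpow_nonneg dist_nonneg δ), div_eq_mul_inv]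

theorem commutatorKernel_swap (δ : ℝ) (h : X → ℝ) (x y : X) :
    commutatorKernel δ h y x = -commutatorKernel δ h x y := by
  rw [commutatorKernel, commutatorKernel, dist_comm, ← neg_div, neg_sub]

/-- Away from the diagonal the kernel is bounded; close to it the kernel is dominated by an
average of `ω_h(t) / t · (t D)^(-δ)` over the scales `t` between `d(x,y) / D` and `2 d(x,y) / D`. -/
theorem enorm_commutatorKernel_le {δ D : ℝ} (hδ : 0 < δ) (hD : 0 < D)
    (hdiam : Metric.ediam (Set.univ : Set X) = ENNReal.ofReal D) (h : X → ℝ) (x y : X) :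
    ‖commutatorKernel δ h x y‖ₑ ≤
      (2 * ⨆ x, ENNReal.ofReal |h x|) * ENNReal.ofReal ((D / 2) ^ (-δ)) +
        ENNReal.ofReal (2 ^ (δ + 1)) * ∫⁻ t in Set.Ioo (0 : ℝ) 1,
          (Metric.closedBall x (t * D)).indicator
            (fun _ => modulus h t / ENNReal.ofReal t * ENNReal.ofReal ((t * D) ^ (-δ))) y := by
  rw [enorm_commutatorKernel]
  rcases eq_or_ne x y with rfl | hxy
  · simp
  have hd : 0 < dist x y := dist_pos.2 hxy
  rcases lt_or_ge (D / 2) (dist x y) with hfar | hnear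
  · refine le_add_right ?_
    rw [ENNReal.ofReal_mul (abs_nonneg _)]
    refine mul_le_mul' (ofReal_abs_sub_le h x y) (ENNReal.ofReal_le_ofReal ?_)
    exact Real.rpow_le_rpow_of_nonpos (by positivity) hfar.le (by linarith)
  · refine le_add_left ?_
    set s : ℝ := dist x y / D
    have hs : 0 < s := by positivity
    have hsD : s * D = dist x y := div_mul_cancel₀ _ hD.ne'
    have hs2 : 2 * s ≤ 1 := by
      have : 2 * (s * D) ≤ D := by linarith
      nlinarith
    -- For `s < t < 2s`, the number `c` is a lower bound for the integrand: `ω_h(t) ≥ |h x - h y|`,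
    -- while `t` and `t D` are replaced by their upper bounds `2s` and `2 d(x,y)`. The interval has
    -- length `s`, so `c s = 2^(-δ-1) |h x - h y| d(x,y)^(-δ)`, which explains the factor `2^(δ+1)`.
    set c : ℝ≥0∞ := ENNReal.ofReal (|h x - h y| / (2 * s) * (2 * dist x y) ^ (-δ))
    have hc : c * ENNReal.ofReal s ≤ ∫⁻ t in Set.Ioo (0 : ℝ) 1,
          (Metric.closedBall x (t * D)).indicator
            (fun _ => modulus h t / ENNReal.ofReal t * ENNReal.ofReal ((t * D) ^ (-δ))) y := by
      calc c * ENNReal.ofReal s = ∫⁻ _ in Set.Ioo s (2 * s), c := by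
            rw [setLIntegral_const, Real.volume_Ioo]
            congr 2
            ring
        _ ≤ ∫⁻ t in Set.Ioo s (2 * s), (Metric.closedBall x (t * D)).indicator
            (fun _ => modulus h t / ENNReal.ofReal t * ENNReal.ofReal ((t * D) ^ (-δ))) y := by
            refine setLIntegral_mono' measurableSet_Ioo fun t ht => ?_
            have ht0 : 0 < t := hs.trans ht.1
            have hle : dist x y ≤ t * D := by rw [← hsD]; gcongr; exact ht.1.le
            rw [Set.indicator_of_mem (by rwa [Metric.mem_closedBall'])]
            rw [show c = ENNReal.ofReal |h x - h y| / ENNReal.ofReal (2 * s) *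
                ENNReal.ofReal ((2 * dist x y) ^ (-δ)) by
              rw [← ENNReal.ofReal_div_of_pos (by positivity), ← ENNReal.ofReal_mul (by positivity)]]
            refine mul_le_mul' (ENNReal.div_le_div (le_modulus h ?_)
              (ENNReal.ofReal_le_ofReal ht.2.le)) (ENNReal.ofReal_le_ofReal
                (Real.rpow_le_rpow_of_nonpos (mul_pos ht0 hD) ?_ (by linarith)))
            · rw [hdiam, ← ENNReal.ofReal_mul ht0.le, edist_dist]
              exact ENNReal.ofReal_le_ofReal hle
            · rw [← hsD, ← mul_assoc]
              exact mul_le_mul_of_nonneg_right ht.2.le hD.le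
        _ ≤ _ := lintegral_mono_set (Set.Ioo_subset_Ioo hs.le hs2)
    refine le_trans (le_of_eq ?_) (mul_le_mul_right hc _)
    rw [← ENNReal.ofReal_mul (by positivity), ← ENNReal.ofReal_mul (by positivity)]
    congr 1
    rw [Real.mul_rpow (by norm_num) hd.le, Real.rpow_add (by norm_num), Real.rpow_one,
      Real.rpow_neg (by norm_num : (0 : ℝ) ≤ 2)]
    have : (0 : ℝ) < 2 ^ δ := by positivity
    field_simp

variable [SecondCountableTopology X] [MeasurableSpace X] [BorelSpace X]

theorem measurable_commutatorKernel (δ : ℝ) {h : X → ℝ} (hh : Measurable h) :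
    Measurable (Function.uncurry (commutatorKernel δ h)) :=
  ((hh.comp measurable_fst).sub (hh.comp measurable_snd)).div
    ((measurable_fst.dist measurable_snd).pow_const δ)

/-- After Fubini, the volume bound `C (t D)^δ` cancels the weight `(t D)^(-δ)` and leaves `ω_h(t) /
t`. The scales stop short of `t = 1` because regularity is assumed only for radii strictly below the
diameter. -/
theorem lintegral_average_le {μ : Measure X} [IsFiniteMeasure μ] {δ D C : ℝ} (hD : 0 < D)
    (hdiam : Metric.ediam (Set.univ : Set X) = ENNReal.ofReal D)
    (hball : ∀ (x : X) (r : ℝ), 0 ≤ r → ENNReal.ofReal r < Metric.ediam (Set.univ : Set X) →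
      μ (Metric.closedBall x r) ≤ ENNReal.ofReal (C * r ^ δ)) (h : X → ℝ) (x : X) :
    ∫⁻ y, (∫⁻ t in Set.Ioo (0 : ℝ) 1, (Metric.closedBall x (t * D)).indicator
        (fun _ => modulus h t / ENNReal.ofReal t * ENNReal.ofReal ((t * D) ^ (-δ))) y) ∂μ ≤
      ENNReal.ofReal C * diniConst h := by
  have hmt : Measurable fun t : ℝ =>
      modulus h t / ENNReal.ofReal t * ENNReal.ofReal ((t * D) ^ (-δ)) :=
    ((monotone_modulus h).measurable.div ENNReal.measurable_ofReal).mul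
      (((measurable_id.mul_const D).pow_const (-δ)).ennreal_ofReal)
  have hset : MeasurableSet {p : X × ℝ | dist p.1 x ≤ p.2 * D} :=
    measurableSet_le (measurable_fst.dist measurable_const) (measurable_snd.mul_const D)
  have hm : Measurable (Function.uncurry fun (y : X) (t : ℝ) =>
      (Metric.closedBall x (t * D)).indicator
        (fun _ => modulus h t / ENNReal.ofReal t * ENNReal.ofReal ((t * D) ^ (-δ))) y) :=
    (hmt.comp measurable_snd).indicator hset
  rw [lintegral_lintegral_swap hm.aemeasurable, diniConst,
    ← lintegral_const_mul' _ _ ENNReal.ofReal_ne_top]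
  refine le_trans ?_ (lintegral_mono_set Set.Ioo_subset_Ioc_self)
  refine setLIntegral_mono' measurableSet_Ioo fun t ht => ?_
  rw [lintegral_indicator_const measurableSet_closedBall]
  have htD : 0 < t * D := mul_pos ht.1 hD
  have hlt : ENNReal.ofReal (t * D) < Metric.ediam (Set.univ : Set X) := by
    rw [hdiam, ENNReal.ofReal_lt_ofReal_iff hD]
    nlinarith [ht.2]
  calc _ ≤ modulus h t / ENNReal.ofReal t * ENNReal.ofReal ((t * D) ^ (-δ)) *
        ENNReal.ofReal (C * (t * D) ^ δ) := by
        gcongr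
        exact hball x _ htD.le hlt
    _ = ENNReal.ofReal C * (modulus h t / ENNReal.ofReal t) := by
        rw [mul_assoc, ← ENNReal.ofReal_mul (by positivity), mul_comm]
        congr 2
        rw [mul_left_comm, ← Real.rpow_add htD, neg_add_cancel, Real.rpow_zero, mul_one]

/-- The integrals of the commutator kernel are bounded by the Dini norm. -/
theorem exists_lintegral_commutatorKernel_le (μ : Measure X) [IsFiniteMeasure μ] {δ : ℝ}
    (hδ : 0 < δ) (hμ : IsAhlforsRegular δ μ) :
    ∃ C : NNReal, 0 < C ∧ ∀ h : X → ℝ, IsDini h → ∀ x,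
      ∫⁻ y, ‖commutatorKernel δ h x y‖ₑ ∂μ ≤ (C * (diniNorm h).toNNReal : NNReal) := by
  have htop := ediam_ne_top hδ hμ
  obtain ⟨C₀, hC₀, H⟩ := hμ
  set D := (Metric.ediam (Set.univ : Set X)).toReal
  have hdiam : Metric.ediam (Set.univ : Set X) = ENNReal.ofReal D := (ENNReal.ofReal_toReal htop).symm
  rcases (ENNReal.toReal_nonneg : 0 ≤ D).eq_or_lt with h0 | hD
  -- Diameter zero leaves at most one point, and the kernel vanishes on the diagonal.
  · refine ⟨1, one_pos, fun h _ x => ?_⟩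
    have hsub : Subsingleton X := by
      have : Metric.ediam (Set.univ : Set X) = 0 := by
        rw [hdiam, show D = 0 from h0.symm, ENNReal.ofReal_zero]
      exact Set.subsingleton_univ_iff.1 (Metric.ediam_eq_zero_iff.1 this)
    have : ∀ y, ‖commutatorKernel δ h x y‖ₑ = 0 := fun y => by
      simp [commutatorKernel, Subsingleton.elim x y]
    simp [this]
  · set a : NNReal := 2 * ((D / 2) ^ (-δ)).toNNReal * (μ Set.univ).toNNReal
    set b : NNReal := ((2 : ℝ) ^ (δ + 1)).toNNReal * C₀.toNNReal
    refine ⟨a + b + 1, by positivity, fun h hh x => ?_⟩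
    have ha : (2 * ⨆ x, ENNReal.ofReal |h x|) * ENNReal.ofReal ((D / 2) ^ (-δ)) * μ Set.univ =
        a * ⨆ x, ENNReal.ofReal |h x| := by
      simp only [a, ENNReal.coe_mul, ENNReal.coe_ofNat, ENNReal.coe_toNNReal (measure_ne_top _ _)]
      simp only [ENNReal.ofReal]
      ring
    have hb : ENNReal.ofReal (2 ^ (δ + 1)) * (ENNReal.ofReal C₀ * diniConst h) =
        b * diniConst h := by
      simp only [b, ENNReal.coe_mul, ENNReal.ofReal, mul_assoc]
    calc ∫⁻ y, ‖commutatorKernel δ h x y‖ₑ ∂μ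
        ≤ ∫⁻ y, ((2 * ⨆ x, ENNReal.ofReal |h x|) * ENNReal.ofReal ((D / 2) ^ (-δ)) +
          ENNReal.ofReal (2 ^ (δ + 1)) * ∫⁻ t in Set.Ioo (0 : ℝ) 1,
            (Metric.closedBall x (t * D)).indicator
              (fun _ => modulus h t / ENNReal.ofReal t * ENNReal.ofReal ((t * D) ^ (-δ))) y) ∂μ :=
          lintegral_mono fun y => enorm_commutatorKernel_le hδ hD hdiam h x y
      _ ≤ a * (⨆ x, ENNReal.ofReal |h x|) + b * diniConst h := by
          rw [lintegral_add_left measurable_const, lintegral_const,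
            lintegral_const_mul' _ _ ENNReal.ofReal_ne_top, ha, ← hb]
          gcongr
          exact lintegral_average_le hD hdiam
            (fun x r hr hr' => (H x r hr hr').2) h x
      _ ≤ (a + b + 1 : NNReal) * ((⨆ x, ENNReal.ofReal |h x|) + diniConst h) := by
          rw [mul_add]
          gcongr
          · exact le_add_right le_self_add
          · exact le_add_right le_add_self
      _ = _ := by rw [← hh.ofReal_diniNorm, ENNReal.coe_mul, ENNReal.ofReal]

end Kernel

/-! ### Multiplication by Dini continuous functions -/

section Commutator

/-- Here `ω_h(t) ≤ L t diam X`, so `ω_h(t) / t` is bounded on `(0, 1]`. These functions serve as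
test functions for density. -/
theorem isDini_of_lipschitzWith {X : Type*} [MetricSpace X] {h : X → ℝ}
    (hd : Metric.ediam (Set.univ : Set X) ≠ ∞) {L : NNReal}
    (hL : LipschitzWith L h) {M : ℝ} (hM : ∀ x, |h x| ≤ M) : IsDini h where
  uniformContinuous := hL.uniformContinuous
  bounded := ⟨M, hM⟩
  diniConst_lt_top := by
    have hω : ∀ t ∈ Set.Ioc (0 : ℝ) 1, modulus h t / ENNReal.ofReal t ≤
        L * Metric.ediam (Set.univ : Set X) := by
      intro t ht
      have ht0 : ENNReal.ofReal t ≠ 0 := (ENNReal.ofReal_pos.2 ht.1).ne'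
      refine ENNReal.div_le_of_le_mul ?_
      refine iSup_le fun x => iSup_le fun y => iSup_le fun hxy => ?_
      rw [← Real.dist_eq, ← edist_dist, mul_assoc, mul_comm (Metric.ediam _)]
      exact (hL x y).trans (by gcongr)
    refine (setLIntegral_mono' measurableSet_Ioc hω).trans_lt ?_
    rw [setLIntegral_const, Real.volume_Ioc]
    exact ENNReal.mul_lt_top (ENNReal.mul_lt_top ENNReal.coe_lt_top hd.lt_top)
      ENNReal.ofReal_lt_top

theorem IsDini.measurable {X : Type*} [MetricSpace X] [MeasurableSpace X] [BorelSpace X]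
    {h : X → ℝ} (hh : IsDini h) : Measurable h :=
  hh.uniformContinuous.continuous.measurable

theorem lintegral_commutatorKernel_swap_le {X : Type*} [MetricSpace X] [MeasurableSpace X]
    {μ : Measure X} {δ : ℝ} {h : X → ℝ} {A : NNReal}
    (hA : ∀ x, ∫⁻ y, ‖commutatorKernel δ h x y‖ₑ ∂μ ≤ A) (y : X) :
    ∫⁻ x, ‖commutatorKernel δ h x y‖ₑ ∂μ ≤ A := by
  simpa only [commutatorKernel_swap δ h y, enorm_neg] using hA y

theorem inner_mulOp_left {X : Type*} [MeasurableSpace X] {μ : Measure X} {h : X → ℝ}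
    (hh : MemLp h ∞ μ) (f g : Lp ℝ 2 μ) :
    inner ℝ (mulOp h hh f) g = inner ℝ f (mulOp h hh g) := by
  rw [L2.inner_def, L2.inner_def]
  refine integral_congr_ae ?_
  filter_upwards [coeFn_mulOp h hh f, coeFn_mulOp h hh g] with x h1 h2
  rw [h1, h2]
  simp only [RCLike.inner_apply, conj_trivial]
  ring

variable {X : Type*} [MetricSpace X] [SecondCountableTopology X] [MeasurableSpace X] [BorelSpace X]
  {μ : Measure X} [IsFiniteMeasure μ] {δ : ℝ} {h : X → ℝ} {A : NNReal}

/-- The increment of `hf` is `h(x) (f(x) - f(y)) + (h(x) - h(y)) f(y)`. The first term is controlled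
by the energy of `f`. In the second, one factor `|h(x) - h(y)|` is bounded by `2M`, and the other
forms the kernel, so the column bound applies to `|k(x,y)| f(y)²`. -/
theorem mulOp_mem_formDomain (hh : IsDini h)
    (hA : ∀ x, ∫⁻ y, ‖commutatorKernel δ h x y‖ₑ ∂μ ≤ A) {f : Lp ℝ 2 μ}
    (hf : f ∈ formDomain δ μ) : mulOp h (hh.memLp_top μ) f ∈ formDomain δ μ := by
  obtain ⟨M, hM⟩ := hh.bounded
  have hfm := measurable_coe_Lp f
  have hmul := coeFn_mulOp h (hh.memLp_top μ) f
  have hf' : Integrable (energyDensity δ (f : X → ℝ) f) (μ.prod μ) := hf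
  have hk := integrable_kernel_mul_sq (measurable_commutatorKernel δ hh.measurable)
    (lintegral_commutatorKernel_swap_le hA) f
  change Integrable (energyDensity δ (mulOp h (hh.memLp_top μ) f : X → ℝ) _) (μ.prod μ)
  rw [integrable_congr (energyDensity_congr δ μ hmul hmul)]
  have hm : Measurable fun x => h x * f x := hh.measurable.mul hfm
  refine Integrable.mono' ((hf'.const_mul (2 * M ^ 2)).add (hk.norm.const_mul (4 * M)))
    (measurable_energyDensity δ hm hm).aestronglyMeasurable (Filter.Eventually.of_forall fun p => ?_)
  rw [Real.norm_eq_abs, abs_of_nonneg (energyDensity_self_nonneg δ _ p)]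
  simp only [Pi.add_apply, energyDensity, commutatorKernel, norm_mul, norm_div, norm_pow,
    Real.norm_eq_abs, sq_abs, abs_of_nonneg (Real.rpow_nonneg (dist_nonneg (x := p.1) (y := p.2)) δ)]
  rw [← mul_div_assoc, div_mul_eq_mul_div, ← mul_div_assoc, ← add_div]
  refine div_le_div_of_nonneg_right ?_ (Real.rpow_nonneg dist_nonneg _)
  have h1 : h p.1 ^ 2 ≤ M ^ 2 := sq_le_sq' (abs_le.1 (hM p.1)).1 (abs_le.1 (hM p.1)).2
  have h2 : (h p.1 - h p.2) ^ 2 ≤ 2 * M * |h p.1 - h p.2| := by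
    rw [← sq_abs, sq]
    refine mul_le_mul_of_nonneg_right ?_ (abs_nonneg _)
    linarith [abs_sub (h p.1) (h p.2), hM p.1, hM p.2]
  have e : h p.1 * f p.1 - h p.2 * f p.2 =
      h p.1 * (f p.1 - f p.2) + (h p.1 - h p.2) * f p.2 := by ring
  rw [e]
  have h3 := mul_le_mul_of_nonneg_right h1 (sq_nonneg (f p.1 - f p.2))
  have h4 := mul_le_mul_of_nonneg_right h2 (sq_nonneg (f p.2))
  nlinarith [sq_nonneg (h p.1 * (f p.1 - f p.2) - (h p.1 - h p.2) * f p.2)]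

/-- `E(hf, g) = E(f, hg) + ⟨K_h f, g⟩`. -/
theorem dirichletForm_mulOp (hh : IsDini h)
    (hA : ∀ x, ∫⁻ y, ‖commutatorKernel δ h x y‖ₑ ∂μ ≤ A) {K : Lp ℝ 2 μ →L[ℝ] Lp ℝ 2 μ}
    (hK : IsIntegralOperator (commutatorKernel δ h) K) (f g : formDomain δ μ) :
    dirichletForm δ μ ⟨mulOp h (hh.memLp_top μ) f, mulOp_mem_formDomain hh hA f.2⟩ g =
      dirichletForm δ μ f ⟨mulOp h (hh.memLp_top μ) g, mulOp_mem_formDomain hh hA g.2⟩ +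
        inner ℝ (K f) (g : Lp ℝ 2 μ) := by
  set hf' : formDomain δ μ := ⟨mulOp h (hh.memLp_top μ) f, mulOp_mem_formDomain hh hA f.2⟩
  set hg' : formDomain δ μ := ⟨mulOp h (hh.memLp_top μ) g, mulOp_mem_formDomain hh hA g.2⟩
  have hi := integrable_kernel_mul_mul (measurable_commutatorKernel δ hh.measurable) hA
    (lintegral_commutatorKernel_swap_le hA) (f : Lp ℝ 2 μ) (g : Lp ℝ 2 μ)
  rw [hK.inner_eq hi]
  set F : X × X → ℝ := fun p => commutatorKernel δ h p.1 p.2 *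
    (f : Lp ℝ 2 μ) p.2 * (g : Lp ℝ 2 μ) p.1
  -- The two cross terms are `F` and its swap; having equal integrals, they absorb the factor `1/2`.
  have hF : ∫ p, F p.swap ∂(μ.prod μ) = ∫ p, F p ∂(μ.prod μ) := integral_prod_swap F
  have key : energyDensity δ ((hf' : Lp ℝ 2 μ) : X → ℝ) (g : Lp ℝ 2 μ) =ᵐ[μ.prod μ]
      fun p => energyDensity δ ((f : Lp ℝ 2 μ) : X → ℝ) (hg' : Lp ℝ 2 μ) p +
        (F p + F p.swap) := by
    have e1 := energyDensity_congr δ μ (coeFn_mulOp h (hh.memLp_top μ) (f : Lp ℝ 2 μ))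
      (ae_eq_refl ((g : Lp ℝ 2 μ) : X → ℝ))
    have e2 := energyDensity_congr δ μ (ae_eq_refl ((f : Lp ℝ 2 μ) : X → ℝ))
      (coeFn_mulOp h (hh.memLp_top μ) (g : Lp ℝ 2 μ))
    filter_upwards [e1, e2] with p h1 h2
    rw [h1, h2]
    simp only [energyDensity, F, Prod.fst_swap, Prod.snd_swap, commutatorKernel, dist_comm p.2 p.1]
    ring
  change (1 / 2 : ℝ) * ∫ p, energyDensity δ ((hf' : Lp ℝ 2 μ) : X → ℝ) (g : Lp ℝ 2 μ) p ∂(μ.prod μ) =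
    (1 / 2 : ℝ) * ∫ p, energyDensity δ ((f : Lp ℝ 2 μ) : X → ℝ) (hg' : Lp ℝ 2 μ) p ∂(μ.prod μ) +
      ∫ p, F p ∂(μ.prod μ)
  rw [integral_congr_ae key, integral_add (integrable_energyDensity f hg')
    (g := fun p : X × X => F p + F p.swap) (hi.add hi.swap), integral_add (g := fun p : X × X => F p.swap) hi hi.swap, hF]
  ring

theorem mulOp_mem_formOperatorGraph (hh : IsDini h)
    (hA : ∀ x, ∫⁻ y, ‖commutatorKernel δ h x y‖ₑ ∂μ ≤ A) {K : Lp ℝ 2 μ →L[ℝ] Lp ℝ 2 μ}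
    (hK : IsIntegralOperator (commutatorKernel δ h) K) {f u : Lp ℝ 2 μ}
    (hfu : (f, u) ∈ formOperatorGraph (dirichletForm δ μ)) :
    (mulOp h (hh.memLp_top μ) f, mulOp h (hh.memLp_top μ) u + K f) ∈
      formOperatorGraph (dirichletForm δ μ) := by
  obtain ⟨w, v, hv, hp⟩ := hfu
  obtain ⟨rfl, rfl⟩ := Prod.mk.inj hp
  refine ⟨mulOp h (hh.memLp_top μ) w + K v,
    ⟨mulOp h (hh.memLp_top μ) v, mulOp_mem_formDomain hh hA v.2⟩, fun g => ?_, ?_⟩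
  · rw [dirichletForm_mulOp hh hA hK, inner_mulOp_left, inner_add_left, inner_mulOp_left,
      ← add_assoc]
    congr 1
    exact hv ⟨mulOp h (hh.memLp_top μ) g, mulOp_mem_formDomain hh hA g.2⟩
  · simp only [map_sub]
    congr 1
    abel

/-! ### Density of the form domain -/

/-- The constant `1` has zero energy, so multiplying it by bounded Lipschitz functions stays in the
form domain. A vector orthogonal to the domain thus annihilates these functions, and in the limit
the indicators of closed sets, so it is zero. -/
theorem dense_formDomain (hδ : 0 < δ) (hμ : IsAhlforsRegular δ μ) :
    Dense (formDomain δ μ : Set (Lp ℝ 2 μ)) := by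
  obtain ⟨C, -, hC⟩ := exists_lintegral_commutatorKernel_le μ hδ hμ
  rw [Submodule.dense_iff_topologicalClosure_eq_top, Submodule.topologicalClosure_eq_top_iff,
    Submodule.eq_bot_iff]
  intro w hw
  have hw1 : Integrable (w : X → ℝ) μ := (Lp.memLp w).integrable (by norm_num)
  have hone : MemLp (fun _ : X => (1 : ℝ)) 2 μ := memLp_const 1
  have hone_mem : hone.toLp _ ∈ formDomain δ μ := by
    have h0 : energyDensity δ (fun _ : X => (1 : ℝ)) (fun _ => 1) = 0 := by
      funext p
      simp [energyDensity]
    change Integrable (energyDensity δ (hone.toLp _ : X → ℝ) (hone.toLp _)) (μ.prod μ)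
    rw [integrable_congr (energyDensity_congr δ μ hone.coeFn_toLp hone.coeFn_toLp), h0]
    exact integrable_zero _ _ _
  have hlip : ∀ {φ : X → ℝ} {L : NNReal} {M : ℝ}, LipschitzWith L φ → (∀ x, |φ x| ≤ M) →
      ∫ x, φ x * w x ∂μ = 0 := by
    intro φ L M hL hM
    have hφ := isDini_of_lipschitzWith (ediam_ne_top hδ hμ) hL hM
    have h0 := (Submodule.mem_orthogonal _ w).1 hw _
      (mulOp_mem_formDomain hφ (hC φ hφ) hone_mem)
    rw [L2.inner_def] at h0
    rw [← h0]
    refine integral_congr_ae ?_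
    filter_upwards [coeFn_mulOp φ (hφ.memLp_top μ) (hone.toLp _), hone.coeFn_toLp] with x h1 h2
    rw [h1, h2, mul_one]
    exact mul_comm _ _
  -- An integrable function whose integrals over all closed sets vanish is zero almost everywhere.
  -- Thickened indicators are Lipschitz, bounded by `1`, and converge pointwise to the indicator of
  -- a closed set; `|w|` dominates the integrands.
  refine (Lp.eq_zero_iff_ae_eq_zero).2
    (ae_eq_zero_of_forall_setIntegral_isClosed_eq_zero hw1 fun s hs => ?_)
  have hpos : ∀ n : ℕ, (0 : ℝ) < 1 / ((n : ℝ) + 1) := fun n => by positivity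
  have htend := thickenedIndicator_tendsto_indicator_closure hpos
    tendsto_one_div_add_atTop_nhds_zero_nat s
  rw [hs.closure_eq, tendsto_pi_nhds] at htend
  have hle : ∀ n x, ((thickenedIndicator (hpos n) s x : NNReal) : ℝ) ≤ 1 := fun n x =>
    NNReal.coe_le_one.2 (thickenedIndicator_le_one (hpos n) s x)
  have hlim : Filter.Tendsto
      (fun n => ∫ x, ((thickenedIndicator (hpos n) s x : NNReal) : ℝ) * w x ∂μ) Filter.atTop
      (nhds (∫ x, s.indicator (w : X → ℝ) x ∂μ)) := by
    refine tendsto_integral_of_dominated_convergence (fun x => ‖w x‖) (fun n => ?_) hw1.norm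
      (fun n => Filter.Eventually.of_forall fun x => ?_) (Filter.Eventually.of_forall fun x => ?_)
    · exact ((NNReal.continuous_coe.comp (thickenedIndicator (hpos n) s).continuous).measurable.mul
        (measurable_coe_Lp w)).aestronglyMeasurable
    · rw [norm_mul, Real.norm_eq_abs, abs_of_nonneg (NNReal.coe_nonneg _)]
      exact mul_le_of_le_one_left (norm_nonneg _) (hle n x)
    · have := ((NNReal.tendsto_coe.2 (htend x)).mul_const (w x))
      convert this using 2
      by_cases hx : x ∈ s <;> simp [hx]
  rw [← integral_indicator hs.measurableSet]
  refine tendsto_nhds_unique hlim ?_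
  have hzero : ∀ n, ∫ x, ((thickenedIndicator (hpos n) s x : NNReal) : ℝ) * w x ∂μ = 0 := fun n =>
    hlip (M := 1) (L := (1 / ((n : ℝ) + 1)).toNNReal⁻¹)
      (lipschitzWith_thickenedIndicator (hpos n) s)
      (fun x => by rw [abs_of_nonneg (NNReal.coe_nonneg _)]; exact hle n x)
  simp only [hzero]
  exact tendsto_const_nhds

end Commutator

end LogLaplacian

/-! ### The commutator theorem -/

theorem theorem4p9 {X : Type*} [MetricSpace X] [LocallyCompactSpace X]
    [SecondCountableTopology X] [MeasurableSpace X] [BorelSpace X]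
    (μ : Measure X) [IsFiniteMeasure μ] (δ : ℝ) (hδ : 0 < δ)
    (hμ : LogLaplacian.IsAhlforsRegular δ μ) :
    ∃ C : ℝ, 0 < C ∧ ∀ (h : X → ℝ) (hh : LogLaplacian.IsDini h),
      ∃ K : Lp ℝ 2 μ →L[ℝ] Lp ℝ 2 μ,
        LogLaplacian.IsIntegralOperator (LogLaplacian.commutatorKernel δ h) K ∧
        ‖K‖ ≤ C * LogLaplacian.diniNorm h ∧
        ∀ f : (LogLaplacian.logLaplacian δ μ).domain,
          ∃ hf : LogLaplacian.mulOp h (hh.memLp_top μ) (f : Lp ℝ 2 μ) ∈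
              (LogLaplacian.logLaplacian δ μ).domain,
            LogLaplacian.logLaplacian δ μ
                ⟨LogLaplacian.mulOp h (hh.memLp_top μ) (f : Lp ℝ 2 μ), hf⟩ -
              LogLaplacian.mulOp h (hh.memLp_top μ) (LogLaplacian.logLaplacian δ μ f) =
            K (f : Lp ℝ 2 μ) := by
  obtain ⟨C, hC0, hC⟩ := LogLaplacian.exists_lintegral_commutatorKernel_le μ hδ hμ
  refine ⟨C, hC0, fun h hh => ?_⟩
  have hA := hC h hh
  obtain ⟨K, hK, hKA⟩ := LogLaplacian.exists_isIntegralOperator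
    (LogLaplacian.measurable_commutatorKernel δ hh.measurable) hA
    (LogLaplacian.lintegral_commutatorKernel_swap_le hA)
  refine ⟨K, hK, ?_, fun f => ?_⟩
  · rwa [NNReal.coe_mul,
      Real.coe_toNNReal (LogLaplacian.diniNorm h) ENNReal.toReal_nonneg] at hKA
  -- Density of the form domain identifies the graph of `Δ` with the resolvent graph, so membership
  -- of the pair `(hf, hΔf + K f)` gives both the domain statement and the value of `Δ(hf)`.
  · have hgraph : (LogLaplacian.logLaplacian δ μ).graph =
        LogLaplacian.formOperatorGraph (LogLaplacian.dirichletForm δ μ) :=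
      LogLaplacian.formOperator_graph (LogLaplacian.dense_formDomain hδ hμ) _
    have hf := (LogLaplacian.logLaplacian δ μ).mem_graph f
    rw [hgraph] at hf
    have hmul := LogLaplacian.mulOp_mem_formOperatorGraph hh hA hK hf
    rw [← hgraph, LinearPMap.mem_graph_iff] at hmul
    obtain ⟨⟨y, hy⟩, rfl, hy'⟩ := hmul
    exact ⟨hy, by rw [hy', add_sub_cancel_left]⟩
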